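/- Let $(\mathcal X,\rho)$ be a separable complete metric space with its Borel $\sigma$-field, and let $\mathcal Y\subseteq\mathcal X$ be compact. Let $\mathcal N(s)$ be the minimal number of open $\rho$-balls of radius $s$ in $\mathcal X$ whose union contains $\mathcal Y$, and assume that, for some constants $s_0>0$, $0<c_{x,0}<c_{x,1}$ and $\gamma>0$, $$c_{x,0}\,s^{-\gamma}\le \log \mathcal N(s)\le c_{x,1}\,s^{-\gamma}\qquad\text{for all } s\in(0,s_0).$$ Let $\beta\in(0,1]$ and $C>0$, and let $\mathcal G$ be the class of all Borel measurable $g:\mathcal X\to\mathbb R$ with $\sup_{y\in\mathcal Y}|g(y)|\le C$ and $|g(y)-g(z)|\le C\rho(y,z)^\beta$ for all $y,z\in\mathcal Y$. For each $n$ one observes $\mathcal Z_n=\{(X_1,Y_1),\dots,(X_n,Y_n)\}$ with $Y_j=g(X_j)+\varepsilon_j$, where $X_1,\varepsilon_1,\dots,X_n,\varepsilon_n$ are independent, each $X_j$ has the law $P_{X,n}$ (the design measure), and each $\varepsilon_j$ has the same continuously differentiable density $f_\varepsilon$ on $\mathbb R$ with finite Fisher information $\int |f_\varepsilon'(t)|^2/f_\varepsilon(t)\,\mathrm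 dt<\infty$. An estimator $\hat g_n$ of $g$ is a real-valued jointly measurable function $\hat g_n(x)=\hat g_n(x,\mathcal Z_n)$ of $x\in\mathcal X$ and the data; $P_g$ and $E_g$ denote probability and expectation when $g$ is the regression function. (a) There exists a sequence of Borel probability measures $P_{X,n}$ on $\mathcal X$ with $P_{X,n}(\mathcal Y)=1$ for all $n$ such that no sequence of estimators $\{\hat g_n\}_n$ satisfies $$\sup_{g\in\mathcal G}\int E_g|\hat g_n(x)-g(x)|^2\,\mathrm dP_{X,n}(x)=o\bigl((\log n)^{-2\beta/\gamma}\bigr)\qquad(n\to\infty).$$ (b) There is a constant $c>0$, depending only on $C$, $\beta$, $\gamma$ and $c_{x,0}$, such that for every sequence of Borel probability measures $P_{X,n}$ on $\mathcal X$ with $P_{X,n}(\mathcal Y)=1$ for all $n$ and every sequence of estimators $\{\hat g_n\}_n$, $$\liminf_{n\to\infty}\ \sup_{g\in\mathcal G}\ \sup_{x\in\mathcal Y} P_g\bigl[|\hat g_n(x)-g(x)|^2>c\,(\log n)^{-2\beta/\gamma}\bigr]>0.$$ -/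

import Mathlib

open MeasureTheory Filter Topology
open scoped ENNReal

noncomputable section

namespace FunctionalRegression

/-- Covering number: the minimal number of open balls of radius `s`, with centres anywhere in the
ambient space `X`, whose union contains `Y` (it is `⊤` if no finite cover exists). -/
def coveringNumber {X : Type*} [MetricSpace X] (s : ℝ) (Y : Set X) : ℕ∞ :=
  ⨅ (t : Finset X) (_ : Y ⊆ ⋃ x ∈ t, Metric.ball x s), (t.card : ℕ∞)

/-- Metric entropy: the logarithm of the covering number, in `[-∞, ∞]`. -/
def metricEntropy {X : Type*} [MetricSpace X] (s : ℝ) (Y : Set X) : EReal :=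
  ENNReal.log ((coveringNumber s Y : ℕ∞) : ℝ≥0∞)

/-- The two-sided entropy condition
`c₀ s^{-γ} ≤ Φ(s, Y) ≤ c₁ s^{-γ}` for all `s ∈ (0, s₀)`. -/
def EntropyCondition {X : Type*} [MetricSpace X] (Y : Set X) (c₀ c₁ γ s₀ : ℝ) : Prop :=
  ∀ s ∈ Set.Ioo (0 : ℝ) s₀,
    ((c₀ * s ^ (-γ) : ℝ) : EReal) ≤ metricEntropy s Y ∧
      metricEntropy s Y ≤ ((c₁ * s ^ (-γ) : ℝ) : EReal)

/-- The class `𝒢` of Borel measurable regression functions `g : X → ℝ` that are on `Y` bounded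
by `C` and Hölder continuous with exponent `β` and constant `C`. -/
def holderClass {X : Type*} [MetricSpace X] [MeasurableSpace X] (Y : Set X) (β C : ℝ) :
    Set (X → ℝ) :=
  {g | Measurable g ∧ (∀ y ∈ Y, |g y| ≤ C) ∧
    ∀ y ∈ Y, ∀ z ∈ Y, |g y - g z| ≤ C * dist y z ^ β}

/-- `f` is a continuously differentiable probability density on `ℝ` with finite Fisher
information. At a zero of `f` also `deriv f` vanishes (a minimum), and the quotient in the Fisher
information is `0` there, as usual. -/
structure IsFisherDensity (f : ℝ → ℝ) : Prop where
  contDiff : ContDiff ℝ 1 f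
  nonneg : ∀ t, 0 ≤ f t
  lintegral_eq_one : ∫⁻ t, ENNReal.ofReal (f t) = 1
  fisher : ∫⁻ t, ENNReal.ofReal (|deriv f t| ^ 2 / f t) < ∞

/-- The law of an error `ε` with density `f`. -/
def errorLaw (f : ℝ → ℝ) : Measure ℝ :=
  volume.withDensity fun t => ENNReal.ofReal (f t)

/-- The law of one observation `(X₁, Y₁)` with `Y₁ = g(X₁) + ε₁`, where `X₁` has law `P` and `ε₁`
has density `f` and is independent of `X₁`. -/
def obsLaw {X : Type*} [MeasurableSpace X] (P : Measure X) (f : ℝ → ℝ) (g : X → ℝ) :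
    Measure (X × ℝ) :=
  (P.prod (errorLaw f)).map fun p => (p.1, g p.1 + p.2)

/-- The law of the data `(X₁, Y₁), …, (Xₙ, Yₙ)`: `n` independent copies of an observation. -/
def dataLaw {X : Type*} [MeasurableSpace X] (n : ℕ) (P : Measure X) (f : ℝ → ℝ) (g : X → ℝ) :
    Measure (Fin n → X × ℝ) :=
  Measure.pi fun _ => obsLaw P f g

/-- An estimator from `n` observations: a jointly measurable function of the point `x` at which
the regression function is estimated and of the data `z`. -/
def IsEstimator {X : Type*} [MeasurableSpace X] {n : ℕ} (T : X → (Fin n → X × ℝ) → ℝ) : Prop :=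
  Measurable fun p : X × (Fin n → X × ℝ) => T p.1 p.2

/-- The integrated risk `∫ E_g |T(x) - g(x)|² dP(x)`, with values in `[0, ∞]`. -/
def integratedRisk {X : Type*} [MeasurableSpace X] {n : ℕ} (P : Measure X) (f : ℝ → ℝ)
    (g : X → ℝ) (T : X → (Fin n → X × ℝ) → ℝ) : ℝ≥0∞ :=
  ∫⁻ x, ∫⁻ z, ENNReal.ofReal (|T x z - g x| ^ 2) ∂(dataLaw n P f g) ∂P

/-- The rate `(log n)^{-2β/γ}`. -/
def rate (β γ : ℝ) (n : ℕ) : ℝ := Real.log n ^ (-(2 * β / γ))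

end FunctionalRegression

end

universe u

open FunctionalRegression

namespace FunctionalRegression

/-! ### Separated sets -/

/-! The entropy lower bound makes `Y` so rich that `n` design points must miss part of it at a scale
of order `(log n)^(-1/γ)`. At scale `s = (c₀ / (2 log n))^(1/γ)` the covering number is at least
`n²`, hence at least `2n`, so `Y` contains `2n` points that are `s`-separated, and the balls of
radius `r = s/2` around them are disjoint. A Hölder bump on such a ball has height `C r^β`, whose
square is a constant times the rate. If a ball has design mass at most `1/(2n)`, then with
probability at least `1/2` no observation falls into it; on that event the data have the same law
with or without the bump, so no estimator can tell which holds at the centre. For (b), pigeonhole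
supplies such a ball for any design, and zero is compared with a single bump
(`quarter_le_iSup_measure`). For (a), the uniform design on the `2n` points gives every ball mass
`1/(2n)`, and averaging over all subsets of bumps shows that the errors at all the points add up
(`le_iSup_integratedRisk`). -/

/-- Greedy choice: balls around fewer points than the covering number leave some point of `Y`
uncovered, and that point can be added. -/
theorem exists_separated_of_le_coveringNumber {X : Type*} [MetricSpace X] {s : ℝ} (hs : 0 < s)
    {Y : Set X} (m : ℕ) (hm : (m : ℕ∞) ≤ coveringNumber s Y) :
    ∃ S : Finset X, S.card = m ∧ (∀ p ∈ S, p ∈ Y) ∧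
      ∀ p ∈ S, ∀ q ∈ S, p ≠ q → s ≤ dist p q := by
  classical
  induction m with
  | zero => exact ⟨∅, by simp⟩
  | succ m ih =>
    obtain ⟨S, hcard, hY, hsep⟩ := ih (le_trans (by norm_cast; omega) hm)
    have hcov : ¬ Y ⊆ ⋃ x ∈ S, Metric.ball x s := fun h => by
      have h1 : coveringNumber s Y ≤ (S.card : ℕ∞) := iInf₂_le S h
      have h2 := hm.trans h1
      rw [hcard, Nat.cast_le] at h2
      omega
    obtain ⟨y, hy, hyS⟩ := Set.not_subset.1 hcov
    have hd : ∀ p ∈ S, s ≤ dist y p := fun p hp => by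
      by_contra! h
      exact hyS (Set.mem_biUnion hp h)
    have hyn : y ∉ S := fun h => by
      have := hd y h
      rw [dist_self] at this
      linarith
    refine ⟨insert y S, by rw [Finset.card_insert_of_notMem hyn, hcard], ?_, ?_⟩
    · intro p hp
      rcases Finset.mem_insert.1 hp with rfl | hp
      exacts [hy, hY p hp]
    · intro p hp q hq hne
      rcases Finset.mem_insert.1 hp with rfl | hp <;> rcases Finset.mem_insert.1 hq with hq' | hq
      · exact absurd hq'.symm hne
      · exact hd q hq
      · rw [hq', dist_comm]; exact hd p hp
      · exact hsep p hp q hq hne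

theorem natCast_le_coveringNumber {X : Type*} [MetricSpace X] {s : ℝ} {Y : Set X} {a : ℝ}
    (h : (a : EReal) ≤ metricEntropy s Y) {m : ℕ} (hm : (m : ℝ) ≤ Real.exp a) :
    (m : ℕ∞) ≤ coveringNumber s Y := by
  have h1 : EReal.exp a ≤ ((coveringNumber s Y : ℕ∞) : ℝ≥0∞) := by
    rw [← ENNReal.exp_log ((coveringNumber s Y : ℕ∞) : ℝ≥0∞)]
    exact EReal.exp_monotone h
  rw [EReal.exp_coe] at h1
  have h2 : (m : ℝ≥0∞) ≤ ENNReal.ofReal (Real.exp a) := by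
    rw [← ENNReal.ofReal_natCast]
    exact ENNReal.ofReal_le_ofReal hm
  exact_mod_cast h2.trans h1

/-! ### Bump functions -/

/-- A Hölder bump of radius `r` and height `C r ^ β` around `p`. -/
noncomputable def bump {X : Type*} [MetricSpace X] (β C r : ℝ) (p x : X) : ℝ :=
  C * max 0 (r ^ β - dist x p ^ β)

/-- The sum of the bumps around the points of `S`. -/
noncomputable def bumpSum {X : Type*} [MetricSpace X] (β C r : ℝ) (S : Finset X) (x : X) : ℝ :=
  ∑ p ∈ S, bump β C r p x

section Bump

variable {X : Type*} [MetricSpace X] {β C r : ℝ}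

theorem bump_nonneg (hC : 0 ≤ C) (p x : X) : 0 ≤ bump β C r p x :=
  mul_nonneg hC (le_max_left _ _)

theorem bump_self (hβ : 0 < β) (hr : 0 ≤ r) (p : X) : bump β C r p p = C * r ^ β := by
  rw [bump, dist_self, Real.zero_rpow hβ.ne', sub_zero, max_eq_right (Real.rpow_nonneg hr β)]

theorem bump_le (hC : 0 ≤ C) (hr : 0 ≤ r) (p x : X) : bump β C r p x ≤ C * r ^ β := by
  refine mul_le_mul_of_nonneg_left (max_le (Real.rpow_nonneg hr β) ?_) hC
  linarith [Real.rpow_nonneg (dist_nonneg (x := x) (y := p)) β]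

theorem bump_eq_zero (hβ : 0 < β) (hr : 0 ≤ r) {p x : X} (h : r ≤ dist x p) :
    bump β C r p x = 0 := by
  rw [bump, max_eq_left, mul_zero]
  linarith [Real.rpow_le_rpow hr h hβ.le]

theorem continuous_bump (hβ : 0 < β) (p : X) : Continuous (bump β C r p) :=
  continuous_const.mul (continuous_const.max (continuous_const.sub
    ((continuous_id.dist continuous_const).rpow_const fun _ => Or.inr hβ.le)))

/-- For `β ≤ 1` the power `t ↦ t ^ β` is subadditive, so `dist ^ β` still obeys the triangle
inequality. -/
theorem bump_sub_le (hβ : 0 < β) (hβ1 : β ≤ 1) (hC : 0 ≤ C) (p x y : X) :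
    bump β C r p x - bump β C r p y ≤ C * dist x y ^ β := by
  have h1 : dist y p ^ β ≤ dist x p ^ β + dist x y ^ β := by
    refine (Real.rpow_le_rpow dist_nonneg (dist_triangle y x p) hβ.le).trans ?_
    rw [add_comm, dist_comm y x]
    exact Real.rpow_add_le_add_rpow dist_nonneg dist_nonneg hβ.le hβ1
  have h2 : 0 ≤ dist x y ^ β := Real.rpow_nonneg dist_nonneg β
  rw [bump, bump, ← mul_sub]
  refine mul_le_mul_of_nonneg_left ?_ hC
  rw [sub_le_iff_le_add]
  refine max_le (by positivity) ?_
  linarith [le_max_right 0 (r ^ β - dist y p ^ β)]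

theorem bumpSum_nonneg (hC : 0 ≤ C) (S : Finset X) (x : X) : 0 ≤ bumpSum β C r S x :=
  Finset.sum_nonneg fun p _ => bump_nonneg hC p x

theorem bumpSum_eq_zero (hβ : 0 < β) (hr : 0 ≤ r) {S : Finset X} {x : X}
    (h : ∀ p ∈ S, r ≤ dist x p) : bumpSum β C r S x = 0 :=
  Finset.sum_eq_zero fun p hp => bump_eq_zero hβ hr (h p hp)

theorem bumpSum_eq_bump (hβ : 0 < β) (hr : 0 ≤ r) {S : Finset X}
    (hS : ∀ p ∈ S, ∀ q ∈ S, p ≠ q → 2 * r ≤ dist p q) {p x : X} (hp : p ∈ S)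
    (hx : dist x p < r) : bumpSum β C r S x = bump β C r p x := by
  refine Finset.sum_eq_single_of_mem p hp fun q hq hqp => bump_eq_zero hβ hr ?_
  have := hS p hp q hq hqp.symm
  have := dist_triangle p x q
  rw [dist_comm p x] at this
  linarith

/-- The one-sided form keeps the constant `C` instead of `2 * C`: at most one bump is active at `x`,
and the other bumps at `y` are nonnegative and only help. -/
theorem bumpSum_sub_le (hβ : 0 < β) (hβ1 : β ≤ 1) (hC : 0 ≤ C) (hr : 0 ≤ r) {S : Finset X}
    (hS : ∀ p ∈ S, ∀ q ∈ S, p ≠ q → 2 * r ≤ dist p q) (x y : X) :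
    bumpSum β C r S x - bumpSum β C r S y ≤ C * dist x y ^ β := by
  by_cases h : ∃ p ∈ S, dist x p < r
  · obtain ⟨p, hp, hx⟩ := h
    rw [bumpSum_eq_bump hβ hr hS hp hx]
    have h1 : bump β C r p y ≤ bumpSum β C r S y :=
      Finset.single_le_sum (f := fun q => bump β C r q y) (fun q _ => bump_nonneg hC q y) hp
    linarith [bump_sub_le (r := r) hβ hβ1 hC p x y]
  · push Not at h
    rw [bumpSum_eq_zero hβ hr h]
    have : 0 ≤ C * dist x y ^ β := mul_nonneg hC (Real.rpow_nonneg dist_nonneg β)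
    linarith [bumpSum_nonneg (β := β) (r := r) hC S y]

theorem bumpSum_mem_holderClass [MeasurableSpace X] [BorelSpace X] (hβ : 0 < β) (hβ1 : β ≤ 1)
    (hC : 0 ≤ C) (hr : 0 ≤ r) (hr1 : r ≤ 1) {S : Finset X}
    (hS : ∀ p ∈ S, ∀ q ∈ S, p ≠ q → 2 * r ≤ dist p q) (Y : Set X) :
    bumpSum β C r S ∈ holderClass Y β C := by
  refine ⟨?_, fun y _ => ?_, fun y _ z _ => ?_⟩
  · exact (continuous_finsetSum S fun p _ => continuous_bump hβ p).measurable
  · rw [abs_of_nonneg (bumpSum_nonneg hC S y)]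
    by_cases h : ∃ p ∈ S, dist y p < r
    · obtain ⟨p, hp, hx⟩ := h
      rw [bumpSum_eq_bump hβ hr hS hp hx]
      refine (bump_le hC hr p y).trans ?_
      exact mul_le_of_le_one_right hC (Real.rpow_le_one hr hr1 hβ.le)
    · push Not at h
      rw [bumpSum_eq_zero hβ hr h]
      exact hC
  · rw [abs_le]
    have h1 := bumpSum_sub_le hβ hβ1 hC hr hS y z
    have h2 := bumpSum_sub_le hβ hβ1 hC hr hS z y
    rw [dist_comm] at h2
    constructor <;> linarith

theorem bumpSum_insert_eq [DecidableEq X] (hβ : 0 < β) (hr : 0 ≤ r) {S : Finset X} {p : X}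
    (hp : p ∉ S) {x : X} (hx : x ∉ Metric.ball p r) :
    bumpSum β C r (insert p S) x = bumpSum β C r S x := by
  rw [bumpSum, Finset.sum_insert hp, bump_eq_zero hβ hr (not_lt.1 hx), zero_add, bumpSum]

end Bump

/-! ### Data that avoid a set -/

/-- The event that no design point falls into `A`. -/
def avoids {X : Type*} (n : ℕ) (A : Set X) : Set (Fin n → X × ℝ) :=
  Set.univ.pi fun _ => Aᶜ ×ˢ Set.univ

section Avoid

variable {X : Type*} [MeasurableSpace X] {f : ℝ → ℝ}

theorem isProbabilityMeasure_errorLaw (hf : IsFisherDensity f) :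
    IsProbabilityMeasure (errorLaw f) :=
  ⟨by rw [errorLaw, withDensity_apply _ MeasurableSet.univ, Measure.restrict_univ,
    hf.lintegral_eq_one]⟩

theorem measurable_obs {g : X → ℝ} (hg : Measurable g) :
    Measurable fun p : X × ℝ => (p.1, g p.1 + p.2) :=
  measurable_fst.prodMk ((hg.comp measurable_fst).add measurable_snd)

theorem isProbabilityMeasure_obsLaw {P : Measure X} [IsProbabilityMeasure P] (hf : IsFisherDensity f) {g : X → ℝ} (hg : Measurable g) :
    IsProbabilityMeasure (obsLaw P f g) := by
  have := isProbabilityMeasure_errorLaw hf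
  exact Measure.isProbabilityMeasure_map (measurable_obs hg).aemeasurable

theorem obsLaw_compl_prod_univ {P : Measure X} (hf : IsFisherDensity f) {g : X → ℝ} (hg : Measurable g)
    {A : Set X} (hA : MeasurableSet A) : obsLaw P f g (Aᶜ ×ˢ Set.univ) = P Aᶜ := by
  have := isProbabilityMeasure_errorLaw hf
  rw [obsLaw, Measure.map_apply (measurable_obs hg) (hA.compl.prod MeasurableSet.univ)]
  have : (fun p : X × ℝ => (p.1, g p.1 + p.2)) ⁻¹' (Aᶜ ×ˢ Set.univ) = Aᶜ ×ˢ Set.univ := by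
    ext; simp
  rw [this, Measure.prod_prod, measure_univ, mul_one]

theorem obsLaw_restrict_congr {P : Measure X} {g g' : X → ℝ} (hg : Measurable g)
    (hg' : Measurable g') {A : Set X} (hA : MeasurableSet A) (h : ∀ x ∉ A, g x = g' x) :
    (obsLaw P f g).restrict (Aᶜ ×ˢ Set.univ) = (obsLaw P f g').restrict (Aᶜ ×ˢ Set.univ) := by
  have hm : MeasurableSet (Aᶜ ×ˢ (Set.univ : Set ℝ)) := hA.compl.prod MeasurableSet.univ
  ext B hB
  rw [Measure.restrict_apply hB, Measure.restrict_apply hB, obsLaw, obsLaw,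
    Measure.map_apply (measurable_obs hg) (hB.inter hm),
    Measure.map_apply (measurable_obs hg') (hB.inter hm)]
  congr 1
  ext ⟨x, e⟩
  simp only [Set.mem_preimage, Set.mem_inter_iff, Set.mem_prod, Set.mem_compl_iff, Set.mem_univ,
    and_true]
  refine and_congr_left fun hx => ?_
  rw [h x hx]

variable {P : Measure X} [IsProbabilityMeasure P]

theorem dataLaw_avoids (hf : IsFisherDensity f) {g : X → ℝ} (hg : Measurable g) (n : ℕ)
    {A : Set X} (hA : MeasurableSet A) : dataLaw n P f g (avoids n A) = P Aᶜ ^ n := by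
  have := isProbabilityMeasure_obsLaw (P := P) hf hg
  rw [dataLaw, avoids, Measure.pi_pi]
  simp [obsLaw_compl_prod_univ hf hg hA]

theorem dataLaw_restrict_congr (hf : IsFisherDensity f) {g g' : X → ℝ} (hg : Measurable g)
    (hg' : Measurable g') (n : ℕ) {A : Set X} (hA : MeasurableSet A)
    (h : ∀ x ∉ A, g x = g' x) :
    (dataLaw n P f g).restrict (avoids n A) = (dataLaw n P f g').restrict (avoids n A) := by
  have := isProbabilityMeasure_obsLaw (P := P) hf hg
  have := isProbabilityMeasure_obsLaw (P := P) hf hg'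
  rw [dataLaw, dataLaw, avoids, Measure.restrict_pi_pi, Measure.restrict_pi_pi,
    obsLaw_restrict_congr hg hg' hA h]

/-- Bernoulli's inequality: `(1 - 1/(2n))^n ≥ 1 - n/(2n)`. -/
theorem half_le_one_sub_pow {x : ℝ≥0∞} {n : ℕ} (hn : n ≠ 0) (hx : x ≤ (2 * n : ℝ≥0∞)⁻¹) :
    1 / 2 ≤ (1 - x) ^ n := by
  have hn' : (1 : ℝ) ≤ n := by exact_mod_cast Nat.one_le_iff_ne_zero.2 hn
  have h0 : (2 * n : ℝ≥0∞)⁻¹ = ENNReal.ofReal ((2 * n : ℝ)⁻¹) := by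
    rw [ENNReal.ofReal_inv_of_pos (by positivity), ENNReal.ofReal_mul (by norm_num)]
    simp
  have hle : (2 * n : ℝ)⁻¹ ≤ 1 / 2 := by
    rw [inv_le_comm₀ (by positivity) (by norm_num)]
    linarith
  calc (1 / 2 : ℝ≥0∞) = ENNReal.ofReal (1 / 2) := by
        rw [ENNReal.ofReal_div_of_pos (by norm_num)]; simp
    _ ≤ ENNReal.ofReal ((1 - (2 * n : ℝ)⁻¹) ^ n) := by
        refine ENNReal.ofReal_le_ofReal ?_
        have := one_add_mul_le_pow (a := -(2 * n : ℝ)⁻¹) (by linarith) n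
        rw [← sub_eq_add_neg] at this
        refine le_trans (le_of_eq ?_) this
        field_simp
        ring
    _ = (1 - (2 * n : ℝ≥0∞)⁻¹) ^ n := by
        rw [ENNReal.ofReal_pow (by linarith), ENNReal.ofReal_sub _ (by positivity), h0,
          ENNReal.ofReal_one]
    _ ≤ (1 - x) ^ n := by gcongr

theorem half_le_dataLaw_avoids (hf : IsFisherDensity f) {g : X → ℝ} (hg : Measurable g) {n : ℕ}
    (hn : n ≠ 0) {A : Set X} (hA : MeasurableSet A) (hPA : P A ≤ (2 * n : ℝ≥0∞)⁻¹) :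
    1 / 2 ≤ dataLaw n P f g (avoids n A) := by
  rw [dataLaw_avoids hf hg n hA, prob_compl_eq_one_sub hA]
  exact half_le_one_sub_pow hn hPA

/-! ### Two hypotheses that agree off a set of small design mass -/

/-- Two-point argument: both data laws dominate a common measure `ν` of mass at least `1/2`, and no
single estimate is within `√t` of both `a` and `b`. -/
theorem half_le_add_measure_of_eq_off (hf : IsFisherDensity f) {g g' : X → ℝ}
    (hg : Measurable g) (hg' : Measurable g') {n : ℕ} (hn : n ≠ 0) {A : Set X}
    (hA : MeasurableSet A) (hPA : P A ≤ (2 * n : ℝ≥0∞)⁻¹) (h : ∀ x ∉ A, g x = g' x)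
    (U : (Fin n → X × ℝ) → ℝ) (a b t : ℝ) (ht : 4 * t < (a - b) ^ 2) :
    1 / 2 ≤ dataLaw n P f g {z | t < |U z - a| ^ 2} +
      dataLaw n P f g' {z | t < |U z - b| ^ 2} := by
  set ν := (dataLaw n P f g).restrict (avoids n A) with hν
  have hν' : ν = (dataLaw n P f g').restrict (avoids n A) :=
    dataLaw_restrict_congr hf hg hg' n hA h
  calc 1 / 2 ≤ dataLaw n P f g (avoids n A) := half_le_dataLaw_avoids hf hg hn hA hPA
    _ = ν Set.univ := by rw [hν, Measure.restrict_apply_univ]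
    _ ≤ ν ({z | t < |U z - a| ^ 2} ∪ {z | t < |U z - b| ^ 2}) := by
        refine measure_mono fun z _ => ?_
        by_contra hz
        simp only [Set.mem_union, Set.mem_ofPred_eq, not_or, not_lt, sq_abs] at hz
        -- Parallelogram law: `(a - b)² ≤ 2 (u - a)² + 2 (u - b)² ≤ 4 t`.
        nlinarith [sq_nonneg ((U z - a) + (U z - b)), hz.1, hz.2]
    _ ≤ ν {z | t < |U z - a| ^ 2} + ν {z | t < |U z - b| ^ 2} := measure_union_le _ _
    _ ≤ _ := by
        refine add_le_add (Measure.restrict_apply_le _ _) ?_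
        rw [hν']
        exact Measure.restrict_apply_le _ _

theorem le_add_lintegral_of_eq_off (hf : IsFisherDensity f) {g g' : X → ℝ}
    (hg : Measurable g) (hg' : Measurable g') {n : ℕ} (hn : n ≠ 0) {A : Set X}
    (hA : MeasurableSet A) (hPA : P A ≤ (2 * n : ℝ≥0∞)⁻¹) (h : ∀ x ∉ A, g x = g' x)
    {U : (Fin n → X × ℝ) → ℝ} (hU : Measurable U) (a b : ℝ) :
    ENNReal.ofReal ((a - b) ^ 2 / 2) * (1 / 2) ≤
      ∫⁻ z, ENNReal.ofReal (|U z - a| ^ 2) ∂(dataLaw n P f g) +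
        ∫⁻ z, ENNReal.ofReal (|U z - b| ^ 2) ∂(dataLaw n P f g') := by
  set ν := (dataLaw n P f g).restrict (avoids n A) with hν
  have hν' : ν = (dataLaw n P f g').restrict (avoids n A) :=
    dataLaw_restrict_congr hf hg hg' n hA h
  have hm : Measurable fun z => ENNReal.ofReal (|U z - a| ^ 2) := by fun_prop
  calc ENNReal.ofReal ((a - b) ^ 2 / 2) * (1 / 2)
      ≤ ENNReal.ofReal ((a - b) ^ 2 / 2) * ν Set.univ := by
        rw [hν, Measure.restrict_apply_univ]
        gcongr
        exact half_le_dataLaw_avoids hf hg hn hA hPA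
    _ = ∫⁻ _, ENNReal.ofReal ((a - b) ^ 2 / 2) ∂ν := (lintegral_const _).symm
    _ ≤ ∫⁻ z, (ENNReal.ofReal (|U z - a| ^ 2) + ENNReal.ofReal (|U z - b| ^ 2)) ∂ν := by
        refine lintegral_mono fun z => ?_
        rw [← ENNReal.ofReal_add (by positivity) (by positivity)]
        refine ENNReal.ofReal_le_ofReal ?_
        rw [sq_abs, sq_abs]
        nlinarith [sq_nonneg ((U z - a) + (U z - b))]
    _ = ∫⁻ z, ENNReal.ofReal (|U z - a| ^ 2) ∂ν + ∫⁻ z, ENNReal.ofReal (|U z - b| ^ 2) ∂ν :=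
        lintegral_add_left hm _
    _ ≤ _ := by
        refine add_le_add (setLIntegral_le_lintegral _ _) ?_
        rw [hν']
        exact setLIntegral_le_lintegral _ _

end Avoid

/-! ### Lower bounds from a separated set -/

/-- The uniform distribution on the points of `S`. -/
noncomputable def uniformDesign {X : Type*} [MeasurableSpace X] (S : Finset X) : Measure X :=
  (S.card : ℝ≥0∞)⁻¹ • ∑ p ∈ S, Measure.dirac p

theorem uniformDesign_eq_one {X : Type*} [MeasurableSpace X] {S : Finset X}
    (hS : S.Nonempty) {A : Set X} (hSA : ∀ p ∈ S, p ∈ A) :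
    uniformDesign S A = 1 := by
  have h : ∀ p ∈ S, Measure.dirac p A = 1 := fun p hp => Measure.dirac_apply_of_mem (hSA p hp)
  rw [uniformDesign, Measure.smul_apply, Measure.finsetSum_apply, Finset.sum_congr rfl h,
    Finset.sum_const, nsmul_eq_mul, mul_one, smul_eq_mul, ENNReal.inv_mul_cancel]
  · simpa using hS.ne_empty
  · simp

section LowerBounds

variable {X : Type*} [MetricSpace X] [MeasurableSpace X] [BorelSpace X] {β C r : ℝ} {f : ℝ → ℝ}
  {Y : Set X} {S : Finset X} {n : ℕ}

/-- Pigeonhole: the `2n` balls are disjoint and their total mass is at most one. -/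
theorem exists_measure_ball_le (P : Measure X) [IsProbabilityMeasure P] (hn : n ≠ 0)
    (hcard : S.card = 2 * n) (hS : ∀ p ∈ S, ∀ q ∈ S, p ≠ q → 2 * r ≤ dist p q) :
    ∃ p ∈ S, P (Metric.ball p r) ≤ (2 * n : ℝ≥0∞)⁻¹ := by
  have hne : S.Nonempty := Finset.card_pos.1 (by omega)
  have h0 : (2 * n : ℝ≥0∞) ≠ 0 := by simpa using hn
  have ht : (2 * n : ℝ≥0∞) ≠ ∞ := ENNReal.mul_ne_top (by simp) (by simp)
  have hd : Set.PairwiseDisjoint (S : Set X) fun p => Metric.ball p r := fun p hp q hq hpq =>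
    Metric.ball_disjoint_ball (by linarith [hS p hp q hq hpq])
  obtain ⟨p, hp, hmin⟩ := S.exists_min_image (fun p => P (Metric.ball p r)) hne
  refine ⟨p, hp, ?_⟩
  have h := Finset.card_nsmul_le_sum S _ _ hmin
  rw [← measure_biUnion_finset hd fun p _ => measurableSet_ball, hcard, nsmul_eq_mul,
    Nat.cast_mul, Nat.cast_ofNat, mul_comm] at h
  rw [← one_div, ENNReal.le_div_iff_mul_le (Or.inl h0) (Or.inl ht)]
  exact h.trans prob_le_one

theorem quarter_le_iSup_measure (hβ : 0 < β) (hβ1 : β ≤ 1) (hC : 0 ≤ C) (hr : 0 ≤ r)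
    (hr1 : r ≤ 1) (hf : IsFisherDensity f) (P : Measure X) [IsProbabilityMeasure P] (hn : n ≠ 0)
    (hcard : S.card = 2 * n) (hSY : ∀ p ∈ S, p ∈ Y)
    (hS : ∀ p ∈ S, ∀ q ∈ S, p ≠ q → 2 * r ≤ dist p q)
    (T : X → (Fin n → X × ℝ) → ℝ) {t : ℝ} (ht : 4 * t < (C * r ^ β) ^ 2) :
    1 / 4 ≤ ⨆ g ∈ holderClass Y β C, ⨆ x ∈ Y, dataLaw n P f g {z | t < |T x z - g x| ^ 2} := by
  classical
  obtain ⟨p, hp, hPp⟩ := exists_measure_ball_le P hn hcard hS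
  have h0 : bumpSum β C r (∅ : Finset X) ∈ holderClass Y β C :=
    bumpSum_mem_holderClass hβ hβ1 hC hr hr1 (by simp) Y
  have h1 : bumpSum β C r (insert p (∅ : Finset X)) ∈ holderClass Y β C :=
    bumpSum_mem_holderClass hβ hβ1 hC hr hr1 (by simp) Y
  set M := ⨆ g ∈ holderClass Y β C, ⨆ x ∈ Y, dataLaw n P f g {z | t < |T x z - g x| ^ 2} with hM
  have hle : ∀ g ∈ holderClass Y β C, dataLaw n P f g {z | t < |T p z - g p| ^ 2} ≤ M :=
    fun g hg => le_trans
      (le_iSup₂ (f := fun x (_ : x ∈ Y) => dataLaw n P f g {z | t < |T x z - g x| ^ 2}) p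
        (hSY p hp))
      (le_iSup₂ (f := fun g (_ : g ∈ holderClass Y β C) =>
        ⨆ x ∈ Y, dataLaw n P f g {z | t < |T x z - g x| ^ 2}) g hg)
  have key := half_le_add_measure_of_eq_off (P := P) hf h1.1 h0.1 hn measurableSet_ball hPp
    (fun x hx => bumpSum_insert_eq hβ hr (Finset.notMem_empty p) hx) (T p)
    (bumpSum β C r (insert p (∅ : Finset X)) p) (bumpSum β C r (∅ : Finset X) p) t
    (by simpa [bumpSum, bump_self hβ hr p] using ht)
  have h2 : 1 / 2 ≤ M + M := key.trans (add_le_add (hle _ h1) (hle _ h0))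
  rw [← two_mul] at h2
  rw [ENNReal.div_le_iff (by norm_num) (by norm_num)] at h2 ⊢
  calc (1 : ℝ≥0∞) ≤ 2 * M * 2 := h2
    _ = M * 4 := by ring

theorem uniformDesign_ball (hr : 0 < r) (hS : ∀ p ∈ S, ∀ q ∈ S, p ≠ q → 2 * r ≤ dist p q)
    {p : X} (hp : p ∈ S) : uniformDesign S (Metric.ball p r) = (S.card : ℝ≥0∞)⁻¹ := by
  rw [uniformDesign, Measure.smul_apply, Measure.finsetSum_apply, Finset.sum_eq_single_of_mem p hp,
    Measure.dirac_apply_of_mem (Metric.mem_ball_self hr), smul_eq_mul, mul_one]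
  intro q hq hqp
  rw [Measure.dirac_apply' _ measurableSet_ball, Set.indicator_of_notMem]
  rw [Metric.mem_ball, not_lt]
  linarith [hS q hq p hp hqp]

/-- Assouad's argument: the supremum dominates the average over all subsets `R` of `S`, and at each
`p` the hypotheses pair off as `R`, `insert p R`, which differ only on the ball around `p`. -/
theorem le_iSup_integratedRisk (hβ : 0 < β) (hβ1 : β ≤ 1) (hC : 0 ≤ C) (hr : 0 < r)
    (hr1 : r ≤ 1) (hf : IsFisherDensity f) (hn : n ≠ 0)
    (hcard : S.card = 2 * n) (hS : ∀ p ∈ S, ∀ q ∈ S, p ≠ q → 2 * r ≤ dist p q)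
    {T : X → (Fin n → X × ℝ) → ℝ} (hT : IsEstimator T) :
    ENNReal.ofReal ((C * r ^ β) ^ 2 / 2) * (1 / 4) ≤
      ⨆ g ∈ holderClass Y β C, integratedRisk (uniformDesign S) f g T := by
  classical
  have hne : S.Nonempty := Finset.card_pos.1 (by omega)
  have : IsProbabilityMeasure (uniformDesign S) := ⟨uniformDesign_eq_one hne fun _ _ => trivial⟩
  set M := ⨆ g ∈ holderClass Y β C, integratedRisk (uniformDesign S) f g T with hM
  set L := ENNReal.ofReal ((C * r ^ β) ^ 2 / 2) * (1 / 2) with hL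
  set F : Finset X → X → ℝ≥0∞ := fun R p =>
    ∫⁻ z, ENNReal.ofReal (|T p z - bumpSum β C r R p| ^ 2)
      ∂(dataLaw n (uniformDesign S) f (bumpSum β C r R)) with hF
  have hmem : ∀ R ⊆ S, bumpSum β C r R ∈ holderClass Y β C := fun R hR =>
    bumpSum_mem_holderClass hβ hβ1 hC hr.le hr1
      (fun p hp q hq => hS p (hR hp) q (hR hq)) Y
  have hrisk : ∀ R ⊆ S, ∑ p ∈ S, F R p ≤ S.card * M := fun R hR => by
    have h1 : integratedRisk (uniformDesign S) f (bumpSum β C r R) T ≤ M :=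
      le_iSup₂ (f := fun g (_ : g ∈ holderClass Y β C) =>
        integratedRisk (uniformDesign S) f g T) _ (hmem R hR)
    have h2 : integratedRisk (uniformDesign S) f (bumpSum β C r R) T =
        (S.card : ℝ≥0∞)⁻¹ * ∑ p ∈ S, F R p := by
      rw [integratedRisk]
      conv_lhs => rw [uniformDesign]
      rw [lintegral_smul_measure, lintegral_finsetSum_measure, smul_eq_mul]
      simp_rw [lintegral_dirac]
      rfl
    rw [h2, ← ENNReal.div_eq_inv_mul, ENNReal.div_le_iff (by simpa using hne.ne_empty)
      (by simp)] at h1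
    rwa [mul_comm]
  have hpair : ∀ p ∈ S, 2 ^ (S.card - 1) * L ≤ ∑ R ∈ S.powerset, F R p := fun p hp => by
    have hpe : p ∉ S.erase p := Finset.notMem_erase p S
    rw [← Finset.insert_erase hp, Finset.sum_powerset_insert hpe, Finset.insert_erase hp,
      ← Finset.sum_add_distrib]
    have hc : ((S.erase p).powerset.card : ℝ≥0∞) = 2 ^ (S.card - 1) := by
      rw [Finset.card_powerset, Finset.card_erase_of_mem hp]
      norm_cast
    rw [← hc, ← nsmul_eq_mul]
    refine Finset.card_nsmul_le_sum _ _ _ fun R hR => ?_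
    have hRe := Finset.mem_powerset.1 hR
    have hpR : p ∉ R := fun h => hpe (hRe h)
    have hRS : R ⊆ S := hRe.trans (Finset.erase_subset p S)
    have hb : bumpSum β C r (insert p R) p = C * r ^ β := by
      rw [bumpSum_eq_bump hβ hr.le _ (Finset.mem_insert_self p R) (by simpa using hr),
        bump_self hβ hr.le]
      exact fun q hq q' hq' => hS q (Finset.insert_subset hp hRS hq) q'
        (Finset.insert_subset hp hRS hq')
    have hb0 : bumpSum β C r R p = 0 := bumpSum_eq_zero hβ hr.le fun q hq => by
      have := hS p hp q (hRS hq) fun h => hpR (h ▸ hq)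
      linarith
    have key := le_add_lintegral_of_eq_off (P := uniformDesign S) hf (hmem R hRS).1
      (hmem (insert p R) (Finset.insert_subset hp hRS)).1 hn measurableSet_ball
      (by rw [uniformDesign_ball hr hS hp, hcard]; push_cast; exact le_rfl)
      (fun x hx => (bumpSum_insert_eq hβ hr.le hpR hx).symm)
      (U := T p) (hT.comp measurable_prodMk_left) (bumpSum β C r R p)
      (bumpSum β C r (insert p R) p)
    rw [show (bumpSum β C r R p - bumpSum β C r (insert p R) p) ^ 2 = (C * r ^ β) ^ 2 by
      rw [hb, hb0]; ring] at key
    exact key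
  -- The sum of `F R p` over all `R` and `p` is bounded below point by point through the pairs, and
  -- above subset by subset through the risk.
  have htotal : (S.card : ℝ≥0∞) * (2 ^ (S.card - 1) * L) ≤ 2 ^ S.card * (S.card * M) :=
    calc (S.card : ℝ≥0∞) * (2 ^ (S.card - 1) * L)
        ≤ ∑ p ∈ S, ∑ R ∈ S.powerset, F R p := by
          rw [← nsmul_eq_mul]
          exact Finset.card_nsmul_le_sum _ _ _ hpair
      _ = ∑ R ∈ S.powerset, ∑ p ∈ S, F R p := Finset.sum_comm
      _ ≤ S.powerset.card • (S.card * M) :=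
          Finset.sum_le_card_nsmul _ _ _ fun R hR => hrisk R (Finset.mem_powerset.1 hR)
      _ = _ := by rw [nsmul_eq_mul, Finset.card_powerset]; push_cast; rfl
  have hs : S.card = S.card - 1 + 1 := by omega
  have hk : (S.card : ℝ≥0∞) * 2 ^ (S.card - 1) * L ≤
      (S.card : ℝ≥0∞) * 2 ^ (S.card - 1) * (2 * M) := by
    calc _ = (S.card : ℝ≥0∞) * (2 ^ (S.card - 1) * L) := by ring
      _ ≤ 2 ^ S.card * (S.card * M) := htotal
      _ = 2 ^ (S.card - 1 + 1) * (S.card * M) := by rw [← hs]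
      _ = _ := by ring
  have hk0 : (S.card : ℝ≥0∞) * 2 ^ (S.card - 1) ≠ 0 :=
    mul_ne_zero (by simpa using hne.ne_empty) (by simp)
  have hkt : (S.card : ℝ≥0∞) * 2 ^ (S.card - 1) ≠ ∞ :=
    ENNReal.mul_ne_top (by simp) (by simp)
  have hLM : L ≤ 2 * M := (ENNReal.mul_le_mul_iff_right hk0 hkt).1 hk
  rw [hL, one_div, ← div_eq_mul_inv, ENNReal.div_le_iff (by norm_num) (by norm_num)] at hLM
  rw [one_div, ← div_eq_mul_inv, ENNReal.div_le_iff (by norm_num) (by norm_num)]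
  calc _ ≤ 2 * M * 2 := hLM
    _ = M * 4 := by ring

end LowerBounds

/-! ### The separation radius -/

/-- Half of the separation of `2 n` points of a set of entropy at least `c₀ s ^ (-γ)`. -/
noncomputable def separationRadius (c₀ γ : ℝ) (n : ℕ) : ℝ := (c₀ / (2 * Real.log n)) ^ γ⁻¹ / 2

/-- The ratio of the squared height of the bumps to the rate. -/
noncomputable def heightRatio (β C γ c₀ : ℝ) : ℝ := C ^ 2 * (2 ^ (-β)) ^ 2 * (c₀ / 2) ^ (2 * β / γ)

theorem tendsto_separationRadius {c₀ γ : ℝ} (hγ : 0 < γ) :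
    Tendsto (separationRadius c₀ γ) atTop (𝓝 0) := by
  have h1 : Tendsto (fun n : ℕ => c₀ / (2 * Real.log n)) atTop (𝓝 0) :=
    tendsto_const_nhds.div_atTop
      ((Real.tendsto_log_atTop.comp tendsto_natCast_atTop_atTop).const_mul_atTop two_pos)
  have h2 := (h1.rpow_const (p := γ⁻¹) (Or.inr (by positivity))).div_const 2
  rwa [Real.zero_rpow (by positivity), zero_div] at h2

theorem height_sq_eq {β C γ c₀ : ℝ} (hc₀ : 0 < c₀) {n : ℕ} (hn : 0 < Real.log n) :
    (C * separationRadius c₀ γ n ^ β) ^ 2 = heightRatio β C γ c₀ * rate β γ n := by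
  have e : γ⁻¹ * β * 2 = 2 * β / γ := by ring
  have h : (c₀ / (2 * Real.log n)) = (c₀ / 2) * (Real.log n)⁻¹ := by
    field_simp
  rw [separationRadius, heightRatio, rate, Real.div_rpow (by positivity) (by norm_num),
    ← Real.rpow_mul (by positivity), mul_pow, div_pow, ← Real.rpow_mul_natCast (by positivity),
    Nat.cast_ofNat, e, h, Real.mul_rpow (by positivity) (by positivity), Real.inv_rpow hn.le,
    ← Real.rpow_neg hn.le, Real.rpow_neg two_pos.le β, inv_pow]
  ring

theorem eventually_exists_separated {X : Type*} [MetricSpace X] {Y : Set X} {c₀ c₁ γ s₀ : ℝ}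
    (hγ : 0 < γ) (hc₀ : 0 < c₀) (hs₀ : 0 < s₀) (h : EntropyCondition Y c₀ c₁ γ s₀) :
    ∀ᶠ n : ℕ in atTop, n ≠ 0 ∧ 0 < Real.log n ∧ 0 < separationRadius c₀ γ n ∧
      separationRadius c₀ γ n ≤ 1 ∧ ∃ S : Finset X, S.card = 2 * n ∧ (∀ p ∈ S, p ∈ Y) ∧
        ∀ p ∈ S, ∀ q ∈ S, p ≠ q → 2 * separationRadius c₀ γ n ≤ dist p q := by
  have ht := tendsto_separationRadius (c₀ := c₀) hγ
  filter_upwards [eventually_ge_atTop 2, ht.eventually (gt_mem_nhds one_pos),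
    ht.eventually (gt_mem_nhds (half_pos hs₀))] with n hn h1 h2
  have hn' : (2 : ℝ) ≤ n := by exact_mod_cast hn
  have hlog : 0 < Real.log n := Real.log_pos (by linarith)
  have hb : 0 < c₀ / (2 * Real.log n) := by positivity
  have hpos : 0 < separationRadius c₀ γ n := half_pos (Real.rpow_pos_of_pos hb _)
  refine ⟨by omega, hlog, hpos, h1.le, ?_⟩
  refine exists_separated_of_le_coveringNumber (by positivity) _
    (natCast_le_coveringNumber (h _ ⟨by positivity, by linarith⟩).1 ?_)
  -- The radius is chosen so that the entropy bound exponentiates to `n²`, which is at least `2n`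
  -- because `n ≥ 2`.
  have he : c₀ * (2 * separationRadius c₀ γ n) ^ (-γ) = 2 * Real.log n := by
    rw [separationRadius, mul_div_cancel₀ _ two_ne_zero, ← Real.rpow_mul hb.le,
      show γ⁻¹ * -γ = -1 by field_simp, Real.rpow_neg_one]
    field_simp
  rw [he, two_mul (Real.log n), Real.exp_add, Real.exp_log (by linarith)]
  push_cast
  nlinarith

theorem heightRatio_pos {β C γ c₀ : ℝ} (hC : 0 < C) (hc₀ : 0 < c₀) :
    0 < heightRatio β C γ c₀ := by
  unfold heightRatio
  positivity

end FunctionalRegression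

theorem theorem2 (β C γ c₀ : ℝ) (hβ : 0 < β) (hβ1 : β ≤ 1) (hC : 0 < C) (hγ : 0 < γ)
    (hc₀ : 0 < c₀) :
    ∃ c : ℝ, 0 < c ∧
      ∀ (X : Type u) [MetricSpace X] [CompleteSpace X] [TopologicalSpace.SeparableSpace X]
        [MeasurableSpace X] [BorelSpace X] (Y : Set X) (c₁ s₀ : ℝ) (f : ℝ → ℝ),
        IsCompact Y → c₀ < c₁ → 0 < s₀ → EntropyCondition Y c₀ c₁ γ s₀ → IsFisherDensity f →
        -- part (a)
        (∃ P : ℕ → Measure X, (∀ n, IsProbabilityMeasure (P n)) ∧ (∀ n, P n Y = 1) ∧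
          ∀ T : (n : ℕ) → X → (Fin n → X × ℝ) → ℝ, (∀ n, IsEstimator (T n)) →
            ¬ Tendsto
              (fun n : ℕ => (⨆ g ∈ holderClass Y β C, integratedRisk (P n) f g (T n)) /
                ENNReal.ofReal (rate β γ n))
              atTop (𝓝 0)) ∧
        -- part (b)
        (∀ P : ℕ → Measure X, (∀ n, IsProbabilityMeasure (P n)) → (∀ n, P n Y = 1) →
          ∀ T : (n : ℕ) → X → (Fin n → X × ℝ) → ℝ, (∀ n, IsEstimator (T n)) →
            0 < liminf
              (fun n : ℕ => ⨆ g ∈ holderClass Y β C, ⨆ x ∈ Y,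
                dataLaw n (P n) f g {z | c * rate β γ n < |T n x z - g x| ^ 2})
              atTop) := by
  have hK := heightRatio_pos (β := β) (γ := γ) hC hc₀
  -- Any fraction below `1/4` would do: the two-point bound needs four times the threshold to be
  -- strictly below the squared bump height.
  refine ⟨heightRatio β C γ c₀ / 8, by positivity, ?_⟩
  intro X _ _ _ _ _ Y c₁ s₀ f _ _ hs₀ hY hf
  have hev := eventually_exists_separated hγ hc₀ hs₀ hY
  constructor
  · obtain ⟨N, hN⟩ := eventually_atTop.1 hev
    have hex : ∀ n : ℕ, ∃ P : Measure X, IsProbabilityMeasure P ∧ P Y = 1 ∧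
        (N ≤ n → ∀ T : X → (Fin n → X × ℝ) → ℝ, IsEstimator T →
          ENNReal.ofReal (heightRatio β C γ c₀ * rate β γ n / 2) * (1 / 4) ≤
            ⨆ g ∈ holderClass Y β C, integratedRisk P f g T) := fun n => by
      by_cases hn : N ≤ n
      · obtain ⟨h0, hlog, hr, hr1, S, hcard, hSY, hS⟩ := hN n hn
        have hne : S.Nonempty := Finset.card_pos.1 (by omega)
        refine ⟨uniformDesign S, ⟨uniformDesign_eq_one hne fun _ _ => trivial⟩,
          uniformDesign_eq_one hne hSY, fun _ T hT => ?_⟩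
        rw [← height_sq_eq hc₀ hlog]
        exact le_iSup_integratedRisk hβ hβ1 hC.le hr hr1 hf h0 hcard hS hT
      -- For the finitely many small `n` any design on `Y` serves; the separated set at `N` supplies
      -- a point of `Y` for a Dirac mass.
      · obtain ⟨h0, -, -, -, S, hcard, hSY, -⟩ := hN N le_rfl
        obtain ⟨p, hp⟩ : S.Nonempty := Finset.card_pos.1 (by omega)
        exact ⟨Measure.dirac p, inferInstance, Measure.dirac_apply_of_mem (hSY p hp),
          fun h => absurd h hn⟩
    choose P hP hPY hPT using hex
    refine ⟨P, hP, hPY, fun T hT hlim => ?_⟩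
    have hpos : (0 : ℝ≥0∞) < ENNReal.ofReal (heightRatio β C γ c₀ / 2) * (1 / 4) :=
      ENNReal.mul_pos (by simpa using hK) (by simp)
    obtain ⟨n, ⟨-, hlog, -⟩, hnN, hn⟩ :=
      (hev.and ((eventually_ge_atTop N).and (hlim.eventually (gt_mem_nhds hpos)))).exists
    have hrate : 0 < rate β γ n := Real.rpow_pos_of_pos hlog _
    refine absurd hn (not_lt.2 ?_)
    rw [ENNReal.le_div_iff_mul_le (Or.inl (by simpa using hrate)) (Or.inl (by simp))]
    refine le_trans (le_of_eq ?_) (hPT n hnN (T n) (hT n))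
    rw [mul_right_comm, ← ENNReal.ofReal_mul (by positivity)]
    congr 2
    ring
  · intro P hP _ T _
    have h4 : (0 : ℝ≥0∞) < 1 / 4 := by simp
    refine h4.trans_le (le_liminf_of_le (by isBoundedDefault) ?_)
    filter_upwards [hev] with n ⟨h0, hlog, hr, hr1, S, hcard, hSY, hS⟩
    have hrate : 0 < rate β γ n := Real.rpow_pos_of_pos hlog _
    have := hP n
    refine quarter_le_iSup_measure hβ hβ1 hC.le hr.le hr1 hf (P n) h0 hcard hSY hS (T n) ?_
    rw [height_sq_eq hc₀ hlog]
    nlinarith [mul_pos hK hrate]
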